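/- Let $k$ be a field and let $S$ be a numerical semigroup, i.e. a submonoid of $(\mathbb N,+)$ with finite complement; let $k[[S]]\subseteq k[[t]]$ be the ring of power series all of whose exponents lie in $S$. Let $E$ be an ideal of $S$, i.e. a non-empty subset $E\subseteq S$ with $E+S\subseteq E$, let $e=\min E$, and let $I=(t^a\mid a\in E)\subseteq k[[S]]$. For an ideal $H$ of a ring $R$ write $\widetilde H=\bigcup_{n\ge 1}(H^{n+1}:_R H^n)$ for its Ratliff-Rush closure, and put $h(H)=\min\{n\ge 1\mid H^m=\widetilde{H^m}\ \text{for all } m\ge n\}$. Let $T=\{0\}\cup E$, which is a numerical semigroup, let $M=T\setminus\{0\}$ and $m=\min M$ (so $M=E$ and $m=e$ whenever $0\notin E$), and let $F=e+S$, which is an ideal of $T$. Write $lM=M+\cdots+M$ ($l$ summands, $0M=\{0\}$) and $A-A'=\{z\in\mathbb Z\mid z+A'\subseteq A\}$. The blow-up of $F$ (as an ideal of $T$) is $$B(F)=\bigcup_{j\ge 1}\bigl((F+(j-1)M)-jM\bigr).$$ Let $\alpha_i$ and $\alpha'_i$ be the smallest elements congruent to $i$ modulo $m$ of $F$ and of $B(F)$,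 respectively. Define the microinvariant $a_i(F)\in\mathbb Z$ by $\alpha'_i+m\,a_i(F)=\alpha_i$, and put $b_i(F)=\max\{l+1\mid l\ge 0,\ \alpha_i\in lM+F\}$. Then $h(I)=1$ if and only if $a_i(F)=b_i(F)$ for every $i=0,\dots,e-1$. -/

import Mathlib

open scoped Pointwise

/-! ### Numerical semigroups and their ideals -/

namespace NumSgp

/-- A numerical semigroup: a submonoid of `(ℕ, +)` with finite complement. -/
def IsNumericalSemigroup (S : AddSubmonoid ℕ) : Prop :=
  ((S : Set ℕ)ᶜ).Finite

/-- An ideal of `S`: a nonempty subset `E ⊆ S` with `E + S ⊆ E`. -/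
structure IsIdeal (S : AddSubmonoid ℕ) (E : Set ℕ) : Prop where
  nonempty : E.Nonempty
  subset : E ⊆ (S : Set ℕ)
  add_mem : ∀ a ∈ E, ∀ s ∈ S, a + s ∈ E

/-- The multiplicity `e(E)` of an ideal: its smallest element. -/
noncomputable def idealMult (E : Set ℕ) : ℕ := sInf E

/-- The maximal ideal `M = T \ {0}` of a numerical semigroup. -/
def maxIdeal (T : AddSubmonoid ℕ) : Set ℕ := (T : Set ℕ) \ {0}

/-- The multiplicity of a numerical semigroup: its smallest nonzero element. -/
noncomputable def mult (T : AddSubmonoid ℕ) : ℕ := sInf (maxIdeal T)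

/-- The `l`-fold sumset `lA = A + ⋯ + A`, with `0A = {0}`. -/
def sumset : ℕ → Set ℕ → Set ℕ
  | 0, _ => {0}
  | l + 1, A => sumset l A + A

/-- The difference `A - B = {z ∈ ℤ | z + B ⊆ A}`. -/
def diff (A B : Set ℕ) : Set ℤ :=
  {z | ∀ b ∈ B, ∃ a ∈ A, z + (b : ℤ) = (a : ℤ)}

/-- The blow-up `B(F) = ⋃_{i ≥ 1} ((F + (i - 1)M) - iM)` of an ideal `F` of `T`, where
`M = T \ {0}`; the index below is `j = i - 1`. -/
def blowUp (T : AddSubmonoid ℕ) (F : Set ℕ) : Set ℤ :=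
  ⋃ j : ℕ, diff (F + sumset j (maxIdeal T)) (sumset (j + 1) (maxIdeal T))

/-- The smallest element of `A ⊆ ℤ` congruent to `i` modulo `m`; for `i = 0, …, m - 1` these
are the elements of the Apéry set of `A` with respect to `m`. -/
noncomputable def apery (m : ℕ) (A : Set ℤ) (i : ℕ) : ℤ :=
  sInf {z | z ∈ A ∧ z ≡ (i : ℤ) [ZMOD (m : ℤ)]}

/-- `α_i`: the Apéry set of the ideal `F` of `T` with respect to the multiplicity of `T`. -/
noncomputable def alpha (T : AddSubmonoid ℕ) (F : Set ℕ) (i : ℕ) : ℤ :=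
  apery (mult T) ((fun n : ℕ => (n : ℤ)) '' F) i

/-- `α'_i`: the Apéry set of the blow-up `B(F)` with respect to the multiplicity of `T`. -/
noncomputable def alpha' (T : AddSubmonoid ℕ) (F : Set ℕ) (i : ℕ) : ℤ :=
  apery (mult T) (blowUp T F) i

/-- The microinvariant `a_i(F)`: the integer with `α'_i + m a_i(F) = α_i`, `m` the multiplicity
of `T`. The division is exact, see `alpha'_add_mult_mul_microinv`. -/
noncomputable def microinv (T : AddSubmonoid ℕ) (F : Set ℕ) (i : ℕ) : ℤ :=
  (alpha T F i - alpha' T F i) / (mult T : ℤ)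

/-- `b_i(F) = max {l + 1 | α_i ∈ lM + F}`. The maximum is attained, see `isGreatest_order`. -/
noncomputable def order (T : AddSubmonoid ℕ) (F : Set ℕ) (i : ℕ) : ℕ :=
  sSup {b | ∃ l : ℕ, b = l + 1 ∧ ∃ n ∈ sumset l (maxIdeal T) + F, (n : ℤ) = alpha T F i}

/-- The semigroup `T = {0} ∪ E` attached to an ideal `E` of `S`. -/
def adjoinZero {S : AddSubmonoid ℕ} {E : Set ℕ} (hE : IsIdeal S E) : AddSubmonoid ℕ where
  carrier := {0} ∪ E
  zero_mem' := Or.inl rfl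
  add_mem' := by
    rintro a b (ha | ha) (hb | hb)
    · left
      simp_all
    · right
      simp_all
    · right
      simp_all
    · right
      exact hE.add_mem a ha b (hE.subset hb)

/-- The principal ideal `e + S`. -/
def translate (e : ℕ) (S : AddSubmonoid ℕ) : Set ℕ := {n | ∃ s ∈ S, n = e + s}

/-! ### The objects above are what they should be -/

theorem IsNumericalSemigroup.exists_forall_ge {S : AddSubmonoid ℕ}
    (hS : IsNumericalSemigroup S) : ∃ c : ℕ, ∀ n, c ≤ n → n ∈ S := by
  obtain ⟨c, hc⟩ := hS.bddAbove
  refine ⟨c + 1, fun n hn => ?_⟩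
  by_contra h
  have := hc (show n ∈ (S : Set ℕ)ᶜ from h)
  omega

theorem isNumericalSemigroup_adjoinZero {S : AddSubmonoid ℕ} (hS : IsNumericalSemigroup S)
    {E : Set ℕ} (hE : IsIdeal S E) : IsNumericalSemigroup (adjoinZero hE) := by
  obtain ⟨c, hc⟩ := hS.exists_forall_ge
  obtain ⟨a, ha⟩ := hE.nonempty
  refine (Set.finite_lt_nat (a + c)).subset fun n hn => ?_
  by_contra h
  have h' : a + c ≤ n := not_lt.mp h
  apply hn
  right
  have := hE.add_mem a ha (n - a) (hc _ (by omega))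
  rwa [Nat.add_sub_cancel' (by omega)] at this

theorem isIdeal_translate {S : AddSubmonoid ℕ} {E : Set ℕ} (hE : IsIdeal S E) :
    IsIdeal (adjoinZero hE) (translate (idealMult E) S) where
  nonempty := ⟨_, 0, S.zero_mem, rfl⟩
  subset := by
    rintro _ ⟨s, hs, rfl⟩
    exact Or.inr (hE.add_mem _ (Nat.sInf_mem hE.nonempty) s hs)
  add_mem := by
    rintro _ ⟨s, hs, rfl⟩ t ht
    have ht' : t ∈ S := by
      rcases ht with ht | ht
      · rw [Set.mem_singleton_iff.mp ht]
        exact S.zero_mem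
      · exact hE.subset ht
    exact ⟨s + t, S.add_mem hs ht', by ring⟩

section WellDefined

variable {T : AddSubmonoid ℕ} {F : Set ℕ}

theorem mult_mem (hT : IsNumericalSemigroup T) : mult T ∈ maxIdeal T := by
  obtain ⟨c, hc⟩ := hT.exists_forall_ge
  exact Nat.sInf_mem ⟨c + 1, hc _ (by omega), by simp⟩

theorem mult_pos (hT : IsNumericalSemigroup T) : 0 < mult T :=
  Nat.pos_of_ne_zero (mult_mem hT).2

theorem mul_mult_le_of_mem_sumset {l n : ℕ} (hn : n ∈ sumset l (maxIdeal T)) :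
    l * mult T ≤ n := by
  induction l generalizing n with
  | zero => simp
  | succ l ih =>
    obtain ⟨x, hx, y, hy, rfl⟩ := hn
    have h1 := ih hx
    have h2 : mult T ≤ y := Nat.sInf_le hy
    dsimp only
    rw [Nat.succ_mul]
    omega

theorem mul_mult_mem_sumset (hT : IsNumericalSemigroup T) (l : ℕ) :
    l * mult T ∈ sumset l (maxIdeal T) := by
  induction l with
  | zero => simp [sumset]
  | succ l ih => exact ⟨_, ih, _, mult_mem hT, by ring⟩

theorem subset_blowUp (hF : IsIdeal T F) :
    (fun n : ℕ => (n : ℤ)) '' F ⊆ blowUp T F := by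
  rintro _ ⟨f, hf, rfl⟩
  refine Set.mem_iUnion.mpr ⟨0, fun b hb => ?_⟩
  obtain ⟨x, hx, y, hy, rfl⟩ := hb
  obtain rfl : x = 0 := hx
  exact ⟨f + y, ⟨f + y, hF.add_mem f hf y hy.1, 0, rfl, rfl⟩, by push_cast; ring⟩

theorem neg_mult_le_of_mem_blowUp (hT : IsNumericalSemigroup T) {z : ℤ}
    (hz : z ∈ blowUp T F) : -(mult T : ℤ) ≤ z := by
  obtain ⟨j, hj⟩ := Set.mem_iUnion.mp hz
  obtain ⟨_, ⟨f, hf, y, hy, rfl⟩, h⟩ := hj _ (mul_mult_mem_sumset hT (j + 1))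
  have := mul_mult_le_of_mem_sumset hy
  push_cast at h
  zify at this
  nlinarith

theorem exists_mem_modEq (hT : IsNumericalSemigroup T) (hF : IsIdeal T F) (i : ℕ) :
    ∃ z ∈ (fun n : ℕ => (n : ℤ)) '' F, z ≡ (i : ℤ) [ZMOD (mult T : ℤ)] := by
  obtain ⟨c, hc⟩ := hT.exists_forall_ge
  obtain ⟨f, hf⟩ := hF.nonempty
  have hm := mult_pos hT
  have hle : c + f ≤ (c + f) * mult T := Nat.le_mul_of_pos_right _ hm
  have key := hF.add_mem f hf (i + (c + f) * mult T - f) (hc _ (by omega))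
  rw [Nat.add_sub_cancel' (by omega)] at key
  refine ⟨_, ⟨_, key, rfl⟩, ?_⟩
  push_cast
  exact Int.modEq_iff_dvd.mpr ⟨-(c + f), by ring⟩

theorem isLeast_alpha (hT : IsNumericalSemigroup T) (hF : IsIdeal T F) (i : ℕ) :
    IsLeast {z | z ∈ (fun n : ℕ => (n : ℤ)) '' F ∧ z ≡ (i : ℤ) [ZMOD (mult T : ℤ)]}
      (alpha T F i) := by
  have hne : {z | z ∈ (fun n : ℕ => (n : ℤ)) '' F ∧
      z ≡ (i : ℤ) [ZMOD (mult T : ℤ)]}.Nonempty := exists_mem_modEq hT hF i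
  have hb : BddBelow {z | z ∈ (fun n : ℕ => (n : ℤ)) '' F ∧
      z ≡ (i : ℤ) [ZMOD (mult T : ℤ)]} := by
    refine ⟨0, ?_⟩
    rintro _ ⟨⟨n, -, rfl⟩, -⟩
    exact Int.natCast_nonneg n
  exact ⟨Int.csInf_mem hne hb, fun z hz => csInf_le hb hz⟩

theorem isLeast_alpha' (hT : IsNumericalSemigroup T) (hF : IsIdeal T F) (i : ℕ) :
    IsLeast {z | z ∈ blowUp T F ∧ z ≡ (i : ℤ) [ZMOD (mult T : ℤ)]} (alpha' T F i) := by
  have hne : {z | z ∈ blowUp T F ∧ z ≡ (i : ℤ) [ZMOD (mult T : ℤ)]}.Nonempty := by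
    obtain ⟨z, hz, h⟩ := exists_mem_modEq hT hF i
    exact ⟨z, subset_blowUp hF hz, h⟩
  have hb : BddBelow {z | z ∈ blowUp T F ∧ z ≡ (i : ℤ) [ZMOD (mult T : ℤ)]} :=
    ⟨-(mult T : ℤ), fun z hz => neg_mult_le_of_mem_blowUp hT hz.1⟩
  exact ⟨Int.csInf_mem hne hb, fun z hz => csInf_le hb hz⟩

/-- The defining equation of the microinvariants. -/
theorem alpha'_add_mult_mul_microinv (hT : IsNumericalSemigroup T) (hF : IsIdeal T F) (i : ℕ) :
    alpha' T F i + (mult T : ℤ) * microinv T F i = alpha T F i := by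
  have h1 := (isLeast_alpha hT hF i).1.2
  have h2 := (isLeast_alpha' hT hF i).1.2
  have h3 : (mult T : ℤ) ∣ alpha T F i - alpha' T F i :=
    Int.modEq_iff_dvd.mp (h2.trans h1.symm)
  rw [microinv, Int.mul_ediv_cancel' h3]
  ring

/-- The maximum defining `b_i(F)` is attained. -/
theorem isGreatest_order (hT : IsNumericalSemigroup T) (hF : IsIdeal T F) (i : ℕ) :
    IsGreatest {b | ∃ l : ℕ, b = l + 1 ∧
      ∃ n ∈ sumset l (maxIdeal T) + F, (n : ℤ) = alpha T F i} (order T F i) := by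
  obtain ⟨f, hf, hfa⟩ := (isLeast_alpha hT hF i).1.1
  have hne : {b | ∃ l : ℕ, b = l + 1 ∧
      ∃ n ∈ sumset l (maxIdeal T) + F, (n : ℤ) = alpha T F i}.Nonempty :=
    ⟨1, 0, rfl, f, ⟨0, rfl, f, hf, zero_add f⟩, hfa⟩
  have hb : BddAbove {b | ∃ l : ℕ, b = l + 1 ∧
      ∃ n ∈ sumset l (maxIdeal T) + F, (n : ℤ) = alpha T F i} := by
    refine ⟨f + 1, ?_⟩
    rintro _ ⟨l, rfl, _, ⟨x, hx, y, hy, rfl⟩, h⟩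
    have h1 := mul_mult_le_of_mem_sumset hx
    have h2 : l ≤ l * mult T := Nat.le_mul_of_pos_right _ (mult_pos hT)
    have h3 : x + y = f := by
      have h4 : ((x + y : ℕ) : ℤ) = (f : ℤ) := h.trans hfa.symm
      exact_mod_cast h4
    omega
  exact ⟨Nat.sSup_mem hne hb, fun b h => le_csSup hb h⟩

end WellDefined

/-! ### The semigroup ring `k[[S]]` and its monomial ideals -/

/-- The numerical semigroup ring `k[[S]]`: the power series whose exponents lie in `S`. -/
noncomputable def semigroupRing (k : Type*) [Field k] (S : AddSubmonoid ℕ) :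
    Subalgebra k (PowerSeries k) where
  carrier := {f | ∀ n, PowerSeries.coeff n f ≠ 0 → n ∈ S}
  add_mem' := by
    intro f g hf hg n hn
    by_cases h : PowerSeries.coeff n f = 0
    · refine hg n fun h' => hn ?_
      rw [map_add, h, h', add_zero]
    · exact hf n h
  mul_mem' := by
    intro f g hf hg n hn
    rw [PowerSeries.coeff_mul] at hn
    obtain ⟨p, hp, hpn⟩ := Finset.exists_ne_zero_of_sum_ne_zero hn
    rw [← Finset.HasAntidiagonal.mem_antidiagonal.mp hp]
    exact S.add_mem (hf _ (left_ne_zero_of_mul hpn)) (hg _ (right_ne_zero_of_mul hpn))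
  algebraMap_mem' := by
    intro r n hn
    have h : n = 0 := by
      by_contra h
      apply hn
      rw [PowerSeries.algebraMap_apply, PowerSeries.coeff_C, if_neg h]
    rw [h]
    exact S.zero_mem

/-- The ideal `(t^a | a ∈ E)` of `k[[S]]`. -/
noncomputable def monomialIdeal (k : Type*) [Field k] (S : AddSubmonoid ℕ) (E : Set ℕ) :
    Ideal (semigroupRing k S) :=
  Ideal.span {f | ∃ a ∈ E, (f : PowerSeries k) = PowerSeries.X ^ a}

end NumSgp

/-! ### The Ratliff-Rush closure -/

section RatliffRush

/-- The Ratliff-Rush closure `⋃_{n ≥ 1} (I^{n+1} : I^n)` of an ideal. -/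
def ratliffRush {R : Type*} [CommRing R] (I : Ideal R) : Ideal R where
  carrier := {x | ∃ n : ℕ, 1 ≤ n ∧ x ∈ (I ^ (n + 1)).colon (I ^ n : Ideal R)}
  zero_mem' := ⟨1, le_rfl, Ideal.zero_mem _⟩
  add_mem' := by
    have mono : ∀ (x : R) (n m : ℕ), n ≤ m → x ∈ (I ^ (n + 1)).colon (I ^ n : Ideal R) →
        x ∈ (I ^ (m + 1)).colon (I ^ m : Ideal R) := by
      intro x n m hnm h
      rw [Submodule.mem_colon] at h ⊢
      intro y hy
      rw [SetLike.mem_coe] at hy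
      obtain ⟨d, rfl⟩ := Nat.exists_eq_add_of_le hnm
      rw [pow_add] at hy
      refine Submodule.mul_induction_on hy (fun a ha b hb => ?_) (fun a b ha hb => ?_)
      · rw [smul_eq_mul, ← mul_assoc, show n + d + 1 = (n + 1) + d by ring, pow_add]
        exact Ideal.mul_mem_mul (h a ha) hb
      · rw [smul_add]
        exact Ideal.add_mem _ ha hb
    rintro a b ⟨n, hn, ha⟩ ⟨m, hm, hb⟩
    exact ⟨n + m, by omega,
      Ideal.add_mem _ (mono a n _ (by omega) ha) (mono b m _ (by omega) hb)⟩
  smul_mem' := by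
    rintro c x ⟨n, hn, h⟩
    exact ⟨n, hn, Ideal.mul_mem_left _ c h⟩

/-- The asymptotic Ratliff-Rush number: the least `n ≥ 1` such that `I^m` equals its
Ratliff-Rush closure for all `m ≥ n`. -/
noncomputable def asymptoticRatliffRush {R : Type*} [CommRing R] (I : Ideal R) : ℕ :=
  sInf {n : ℕ | 1 ≤ n ∧ ∀ m, n ≤ m → I ^ m = ratliffRush (I ^ m)}

end RatliffRush

/-!
Write `e = min E` and let `P n = nE + S`, so that `P 0 = S` and `P n = nE` for `n ≥ 1`.

On the ring side everything is monomial: a power series belongs to `I ^ n` exactly when its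
exponents lie in `P n` (`NumSgp.mem_monomialIdeal_pow_iff`), so `I ^ m` equals its Ratliff-Rush
closure exactly when every `s ∈ S` with `s + P (m * n) ⊆ P (m * (n + 1))` for some `n ≥ 1` lies in
`P m` (`NumSgp.pow_eq_ratliffRush_iff`).

Suppose `0 ∉ E`. The sets `P n - n * e` increase and stabilise
(`NumSgp.IsIdeal.exists_idealPow_add`), and their union is the blow-up `B` of `F = e + S`
(`NumSgp.mem_blowUp_translate_iff`). Hence the condition on `s` above is `s - m * e ∈ B`
(`NumSgp.exists_forall_add_mem_idealPow_iff`), and `h(I) = 1` means that `s ∈ S` and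
`s - m * e ∈ B` imply `s ∈ P m` for all `m ≥ 1`.

Let `w` be the least element of `S` congruent to `i` modulo `e`, so that
`w = α_i - e = α'_i + (a_i - 1) * e`. Then `w - l * e ∈ B` forces `l ≤ a_i - 1`, while `b_i - 1` is
the largest `l` with `w ∈ P l`; so `b_i ≤ a_i`, with equality if and only if `w ∈ P (a_i - 1)`.
The condition for `h(I) = 1`, applied to `w`, gives this. Conversely an element `s ∈ S` in the class
of `i` is `w + k * e` with `k ≥ 0`, and `s - m * e ∈ B` forces `m ≤ a_i - 1 + k`, so
`s ∈ P (a_i - 1) + k * e ⊆ P m` (`NumSgp.forall_microinv_eq_order_iff`).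

If `0 ∈ E`, then `E = S`, `e = 0` and `I` is the unit ideal, and both sides hold.
-/

namespace NumSgp

/-! ### Powers of an ideal of a numerical semigroup -/

variable {S : AddSubmonoid ℕ} {E : Set ℕ}

theorem sumset_eq_nsmul (n : ℕ) (A : Set ℕ) : sumset n A = n • A := by
  induction n with
  | zero => simp [sumset, ← Set.singleton_zero]
  | succ n ih => rw [sumset, ih, succ_nsmul]

/-- The set `nE + S` of exponents of the monomials in the `n`-th power of `(t^a | a ∈ E)`. For
`n ≥ 1` and `E` an ideal of `S` it is `nE`, see `IsIdeal.idealPow_eq_sumset`; adding `S` gives the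
value `S` at `n = 0`, which corresponds to the unit ideal. -/
def idealPow (S : AddSubmonoid ℕ) (E : Set ℕ) (n : ℕ) : Set ℕ := sumset n E + (S : Set ℕ)

theorem idealPow_zero : idealPow S E 0 = S := by
  simp [idealPow, sumset, Set.singleton_zero]

theorem idealPow_add (m n : ℕ) :
    idealPow S E (m + n) = idealPow S E m + idealPow S E n := by
  simp only [idealPow, sumset_eq_nsmul]
  rw [add_add_add_comm, ← add_nsmul, AddSubmonoid.coe_add_self_eq]

theorem add_mem_idealPow {m n x y : ℕ} (hx : x ∈ idealPow S E m) (hy : y ∈ idealPow S E n) :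
    x + y ∈ idealPow S E (m + n) := by
  rw [idealPow_add]
  exact Set.add_mem_add hx hy

theorem mul_mem_idealPow {a : ℕ} (ha : a ∈ E) (n : ℕ) : n * a ∈ idealPow S E n := by
  rw [idealPow, sumset_eq_nsmul]
  exact ⟨n * a, by simpa using Set.nsmul_mem_nsmul (n := n) ha, 0, S.zero_mem, by simp⟩

theorem IsIdeal.sumset_subset (hE : IsIdeal S E) (n : ℕ) : sumset n E ⊆ S := by
  induction n with
  | zero => simp [sumset]
  | succ n ih =>
    rintro _ ⟨x, hx, y, hy, rfl⟩
    exact S.add_mem (ih hx) (hE.subset hy)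

theorem IsIdeal.idealPow_subset (hE : IsIdeal S E) (n : ℕ) : idealPow S E n ⊆ S := by
  rintro _ ⟨x, hx, y, hy, rfl⟩
  exact S.add_mem (hE.sumset_subset n hx) hy

theorem IsIdeal.idealPow_antitone (hE : IsIdeal S E) : Antitone (idealPow S E) := by
  intro m n hmn x hx
  obtain ⟨d, rfl⟩ := Nat.exists_eq_add_of_le hmn
  rw [idealPow_add] at hx
  obtain ⟨y, hy, z, hz, rfl⟩ := hx
  have hz' : z ∈ idealPow S E 0 := idealPow_zero ▸ hE.idealPow_subset d hz
  exact add_mem_idealPow hy hz'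

theorem IsIdeal.idealPow_eq_sumset (hE : IsIdeal S E) {n : ℕ} (hn : n ≠ 0) :
    idealPow S E n = sumset n E := by
  obtain ⟨n, rfl⟩ := Nat.exists_eq_succ_of_ne_zero hn
  refine Set.Subset.antisymm ?_ fun x hx => ⟨x, hx, 0, S.zero_mem, add_zero x⟩
  rintro _ ⟨_, ⟨x, hx, y, hy, rfl⟩, s, hs, rfl⟩
  exact ⟨x, hx, y + s, hE.add_mem y hy s hs, (add_assoc x y s).symm⟩

theorem IsIdeal.idealMult_mem (hE : IsIdeal S E) : idealMult E ∈ E := Nat.sInf_mem hE.nonempty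

theorem mul_idealMult_le {n x : ℕ} (hx : x ∈ idealPow S E n) : n * idealMult E ≤ x := by
  obtain ⟨y, hy, s, -, rfl⟩ := hx
  suffices h : ∀ n y, y ∈ sumset n E → n * idealMult E ≤ y from
    (h n y hy).trans (Nat.le_add_right y s)
  intro n
  induction n with
  | zero => simp
  | succ n ih =>
    rintro _ ⟨x, hx, y, hy, rfl⟩
    have h1 := ih x hx
    have h2 : idealMult E ≤ y := Nat.sInf_le hy
    dsimp only
    rw [Nat.succ_mul]
    omega

/-- The powers of `E` are eventually stable: `nE + S` translated by `d * e` is the `(n + d)`-th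
power once `n` is large. The sets `nE + S - n * e` increase with `n` and all contain the cofinite
set `S`, so only finitely many natural numbers can join them. -/
theorem IsIdeal.exists_idealPow_add (hS : IsNumericalSemigroup S) (hE : IsIdeal S E) :
    ∃ N, ∀ n d x, N ≤ n → x ∈ idealPow S E (n + d) →
      ∃ y ∈ idealPow S E n, x = d * idealMult E + y := by
  obtain ⟨c, hc⟩ := hS.exists_forall_ge
  have mono : ∀ {x m n}, m ≤ n → x + m * idealMult E ∈ idealPow S E m →
      x + n * idealMult E ∈ idealPow S E n := by
    intro x m n hmn hx
    obtain ⟨d, rfl⟩ := Nat.exists_eq_add_of_le hmn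
    rw [add_mul, ← add_assoc]
    exact add_mem_idealPow hx (mul_mem_idealPow hE.idealMult_mem d)
  have hex : ∀ x, ∃ N, ∀ n, x + n * idealMult E ∈ idealPow S E n →
      x + N * idealMult E ∈ idealPow S E N := by
    intro x
    by_cases h : ∃ n, x + n * idealMult E ∈ idealPow S E n
    · obtain ⟨N, hN⟩ := h
      exact ⟨N, fun _ _ => hN⟩
    · exact ⟨0, fun n hn => (h ⟨n, hn⟩).elim⟩
  choose N hN using hex
  -- Elements `z ≥ c` already belong to `S`, the set at `n = 0`.
  refine ⟨(Finset.range c).sup N, fun n d x hn hx => ?_⟩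
  obtain ⟨z, rfl⟩ := Nat.exists_eq_add_of_le' (mul_idealMult_le hx)
  refine ⟨z + n * idealMult E, ?_, by ring⟩
  rcases lt_or_ge z c with hz | hz
  · exact mono ((Finset.le_sup (Finset.mem_range.mpr hz)).trans hn) (hN z _ hx)
  · exact mono (Nat.zero_le n) (by simpa [idealPow_zero] using hc z hz)

/-! ### The blow-up and the microinvariants -/

theorem maxIdeal_adjoinZero (hE : IsIdeal S E) (h0 : 0 ∉ E) : maxIdeal (adjoinZero hE) = E := by
  ext x
  change ((x = 0 ∨ x ∈ E) ∧ x ≠ 0) ↔ x ∈ E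
  constructor
  · rintro ⟨h | h, h'⟩
    · exact (h' h).elim
    · exact h
  · exact fun h => ⟨Or.inr h, fun hx => h0 (hx ▸ h)⟩

theorem mult_adjoinZero (hE : IsIdeal S E) (h0 : 0 ∉ E) :
    mult (adjoinZero hE) = idealMult E := by
  rw [mult, maxIdeal_adjoinZero hE h0, idealMult]

theorem mem_translate_add_sumset {e n x : ℕ} :
    x ∈ translate e S + sumset n E ↔ ∃ y ∈ idealPow S E n, x = e + y := by
  constructor
  · rintro ⟨_, ⟨s, hs, rfl⟩, y, hy, rfl⟩
    exact ⟨y + s, ⟨y, hy, s, hs, rfl⟩, by dsimp only; ring⟩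
  · rintro ⟨_, ⟨y, hy, s, hs, rfl⟩, rfl⟩
    exact ⟨e + s, ⟨s, hs, rfl⟩, y, hy, by dsimp only; ring⟩

/-- The blow-up of `e + S` as an ideal of `{0} ∪ E` is `⋃ n, (nE + S - n * e)`: in a large degree
the difference of sets is tested by the single element `n * e`. -/
theorem mem_blowUp_translate_iff (hS : IsNumericalSemigroup S) (hE : IsIdeal S E) (h0 : 0 ∉ E)
    {z : ℤ} :
    z ∈ blowUp (adjoinZero hE) (translate (idealMult E) S) ↔
      ∃ n : ℕ, ∃ x ∈ idealPow S E n, z + (n : ℤ) * (idealMult E : ℤ) = x := by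
  simp only [blowUp, maxIdeal_adjoinZero hE h0, Set.mem_iUnion]
  constructor
  · rintro ⟨j, hj⟩
    have hb : (j + 1) * idealMult E ∈ sumset (j + 1) E := by
      rw [← hE.idealPow_eq_sumset j.succ_ne_zero]
      exact mul_mem_idealPow hE.idealMult_mem _
    obtain ⟨a, ha, h⟩ := hj _ hb
    obtain ⟨y, hy, rfl⟩ := mem_translate_add_sumset.mp ha
    refine ⟨j, y, hy, ?_⟩
    push_cast at h
    linarith
  · rintro ⟨n, x, hx, h⟩
    obtain ⟨N, hN⟩ := hE.exists_idealPow_add hS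
    refine ⟨N + n, fun b hb => ?_⟩
    have hb' : b ∈ idealPow S E (N + n + 1) := by
      rwa [hE.idealPow_eq_sumset (Nat.succ_ne_zero _)]
    obtain ⟨y, hy, rfl⟩ := hN (N + 1) n b (by omega) (by rwa [add_right_comm N 1 n])
    have hxy := add_mem_idealPow hx hy
    obtain ⟨w, hw, h'⟩ :=
      hN (N + n) 1 (x + y) (by omega) (by rwa [show N + n + 1 = n + (N + 1) by ring])
    refine ⟨_, mem_translate_add_sumset.mpr ⟨w, hw, rfl⟩, ?_⟩
    push_cast
    rw [← add_assoc, h]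
    zify at h'
    linarith

/-- The exponents of the Ratliff-Rush closure of the `m`-th power of `E` are the elements of `S`
in the translate by `m * e` of the blow-up. -/
theorem exists_forall_add_mem_idealPow_iff (hS : IsNumericalSemigroup S) (hE : IsIdeal S E)
    (h0 : 0 ∉ E) {m : ℕ} (hm : 1 ≤ m) (s : ℕ) :
    (∃ n, 1 ≤ n ∧ ∀ x ∈ idealPow S E (m * n), s + x ∈ idealPow S E (m * (n + 1))) ↔
      (s : ℤ) - m * idealMult E ∈ blowUp (adjoinZero hE) (translate (idealMult E) S) := by
  rw [mem_blowUp_translate_iff hS hE h0]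
  constructor
  · rintro ⟨n, -, h⟩
    refine ⟨m * (n + 1), _, h _ (mul_mem_idealPow hE.idealMult_mem _), ?_⟩
    push_cast
    ring
  · rintro ⟨n, x, hx, h⟩
    obtain ⟨N, hN⟩ := hE.exists_idealPow_add hS
    refine ⟨n + N + 1, by omega, fun y hy => ?_⟩
    have hle : n + N + 1 ≤ m * (n + N + 1) := Nat.le_mul_of_pos_left _ hm
    obtain ⟨d, hd⟩ : ∃ d, m * (n + N + 1) = N + d + n :=
      ⟨m * (n + N + 1) - N - n, by omega⟩
    rw [hd] at hy
    obtain ⟨w, hw, rfl⟩ := hN (N + d) n y (by omega) hy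
    have key := add_mem_idealPow (add_mem_idealPow (mul_mem_idealPow hE.idealMult_mem m) hx) hw
    have h1 : s + (n * idealMult E + w) = m * idealMult E + x + w := by
      zify
      linarith
    have h2 : m * (n + N + 1 + 1) = m + n + (N + d) := by
      rw [mul_add_one, hd]
      ring
    rwa [h1, h2]

/-- Equality of the invariants `a_i` and `b_i` says exactly that every power of `E` is
Ratliff-Rush closed. Writing `w = α_i - e` for the least element of `S` congruent to `i`, the number
`a_i - 1` is the largest `l` with `w - l * e` in the blow-up, and `b_i - 1` is the largest `l` with
`w ∈ lE + S`. -/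
theorem forall_microinv_eq_order_iff (hS : IsNumericalSemigroup S) (hE : IsIdeal S E)
    (h0 : 0 ∉ E) :
    (∀ i < idealMult E, microinv (adjoinZero hE) (translate (idealMult E) S) i =
        (order (adjoinZero hE) (translate (idealMult E) S) i : ℤ)) ↔
      ∀ m : ℕ, 1 ≤ m → ∀ s ∈ S, (s : ℤ) - m * idealMult E ∈
        blowUp (adjoinZero hE) (translate (idealMult E) S) → s ∈ idealPow S E m := by
  have hT := isNumericalSemigroup_adjoinZero hS hE
  have hF := isIdeal_translate hE
  have hmul := mult_adjoinZero hE h0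
  have he : 0 < idealMult E := hmul ▸ mult_pos hT
  have hmem : ∀ {l x : ℕ}, x ∈ sumset l (maxIdeal (adjoinZero hE)) + translate (idealMult E) S ↔
      ∃ y ∈ idealPow S E l, x = idealMult E + y := by
    intro l x
    rw [maxIdeal_adjoinZero hE h0, add_comm, mem_translate_add_sumset]
  constructor
  · intro h m hm s hs hsB
    obtain ⟨i, hi⟩ : ∃ i, i = s % idealMult E := ⟨_, rfl⟩
    have hsi : (s : ℤ) ≡ i [ZMOD idealMult E] := by
      rw [hi, Int.natCast_mod]
      exact (Int.mod_modEq _ _).symm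
    obtain ⟨l, hl, x, hx, hxα⟩ := (isGreatest_order hT hF i).1
    obtain ⟨w, hw, rfl⟩ := hmem.mp hx
    have hα := isLeast_alpha hT hF i
    have hα' := isLeast_alpha' hT hF i
    have ha := alpha'_add_mult_mul_microinv hT hF i
    rw [h i (hi ▸ Nat.mod_lt _ he), hl, ← hxα, hmul] at ha
    rw [hmul] at hα hα'
    -- `s = w + k * e` with `k ≥ 0`, since `w = α_i - e` is least in `S` in its residue class.
    have h1 : (idealMult E : ℤ) + w ≤ idealMult E + s := by
      have := hα.2 ⟨⟨idealMult E + s, ⟨s, hs, rfl⟩, rfl⟩, by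
        simpa using hsi⟩
      rw [← hxα] at this
      simpa using this
    have h2 : (idealMult E : ℤ) ∣ s - w := by
      have := hα.1.2
      rw [← hxα] at this
      have h3 := Int.modEq_iff_dvd.mp (this.trans hsi.symm)
      push_cast at h3
      have : (s : ℤ) - w = (s - (idealMult E + w)) + idealMult E := by ring
      rw [this]
      exact dvd_add h3 dvd_rfl
    obtain ⟨k, hk⟩ := h2
    have hk0 : 0 ≤ k := by
      by_contra hneg
      have : (idealMult E : ℤ) * k < 0 := mul_neg_of_pos_of_neg (by exact_mod_cast he) (by omega)
      linarith
    lift k to ℕ using hk0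
    have h3 : alpha' (adjoinZero hE) (translate (idealMult E) S) i ≤ s - m * idealMult E := by
      refine hα'.2 ⟨hsB, ?_⟩
      exact
        (Int.modEq_iff_dvd.mpr ⟨m, by ring⟩ : (s : ℤ) - m * idealMult E ≡ s [ZMOD _]).trans hsi
    -- Now `s = α'_i + (l + k) * e` and `s - m * e ≥ α'_i`.
    have h4 : m ≤ l + k := by
      have : (idealMult E : ℤ) * m ≤ idealMult E * (l + k) := by
        push_cast at ha
        linarith
      exact_mod_cast le_of_mul_le_mul_left this (by exact_mod_cast he)
    have h5 : s = w + k * idealMult E := by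
      zify
      linarith
    rw [h5]
    exact hE.idealPow_antitone h4 (add_mem_idealPow hw (mul_mem_idealPow hE.idealMult_mem k))
  · intro h i _
    have hα := isLeast_alpha hT hF i
    have hα' := isLeast_alpha' hT hF i
    have ha := alpha'_add_mult_mul_microinv hT hF i
    have hb := isGreatest_order hT hF i
    set a := microinv (adjoinZero hE) (translate (idealMult E) S) i
    obtain ⟨_, ⟨w, hw, rfl⟩, hwα⟩ := hα.1.1
    rw [hmul] at ha hα hα'
    dsimp only at hwα
    have succ_le_of_mem : ∀ l : ℕ, (w : ℤ) - l * idealMult E ∈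
        blowUp (adjoinZero hE) (translate (idealMult E) S) → (l : ℤ) + 1 ≤ a := by
      intro l hl
      have := hα'.2 ⟨hl, by
        have h1 := hα.1.2
        rw [← hwα] at h1
        refine Int.ModEq.trans (Int.modEq_iff_dvd.mpr ⟨l + 1, ?_⟩) h1
        push_cast
        ring⟩
      have h2 : (idealMult E : ℤ) * (l + 1) ≤ idealMult E * a := by
        push_cast at hwα
        linarith
      exact le_of_mul_le_mul_left h2 (by exact_mod_cast he)
    have ha1 : 1 ≤ a := by
      have := succ_le_of_mem 0 ((mem_blowUp_translate_iff hS hE h0).mpr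
        ⟨0, w, idealPow_zero ▸ hw, by simp⟩)
      simpa using this
    obtain ⟨l, hl⟩ : ∃ l : ℕ, a = l + 1 := ⟨(a - 1).toNat, by omega⟩
    have hwl : w ∈ idealPow S E l := by
      rcases Nat.eq_zero_or_pos l with rfl | hl0
      · exact idealPow_zero ▸ hw
      · refine h l hl0 w hw ?_
        have : (w : ℤ) - l * idealMult E =
            alpha' (adjoinZero hE) (translate (idealMult E) S) i := by
          rw [hl] at ha
          push_cast at hwα
          linarith
        rw [this]
        exact hα'.1.1
    refine le_antisymm ?_ ?_
    · rw [hl]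
      exact_mod_cast hb.2 ⟨l, rfl, _, hmem.mpr ⟨w, hwl, rfl⟩, hwα⟩
    · obtain ⟨l', hl', x, hx, hxα⟩ := hb.1
      obtain ⟨y, hy, rfl⟩ := hmem.mp hx
      obtain rfl : y = w := by
        rw [← hwα] at hxα
        have : idealMult E + y = idealMult E + w := by exact_mod_cast hxα
        omega
      rw [hl']
      exact_mod_cast succ_le_of_mem l' ((mem_blowUp_translate_iff hS hE h0).mpr
        ⟨l', y, hy, by ring⟩)

end NumSgp

namespace NumSgp

/-! ### Powers of monomial ideals of `k[[S]]` and their Ratliff-Rush closures -/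

variable {k : Type*} [Field k] {S : AddSubmonoid ℕ} {E : Set ℕ}

/-- The monomial `c t^n` as an element of `k[[S]]`, for `n ∈ S`. -/
noncomputable def monomial (c : k) {n : ℕ} (hn : n ∈ S) : semigroupRing k S :=
  ⟨PowerSeries.monomial n c, fun m hm => by
    rw [PowerSeries.coeff_monomial] at hm
    split_ifs at hm with h
    · exact h ▸ hn
    · exact (hm rfl).elim⟩

theorem coe_monomial (c : k) {n : ℕ} (hn : n ∈ S) :
    (monomial c hn : PowerSeries k) = PowerSeries.monomial n c := rfl

/-- The ideal generated by `t^a`, `a ∈ A`, consists of all power series with exponents in `A + S`,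
although the span only allows finite combinations: a series of large order is divisible by a single
`t^a`. -/
theorem mem_monomialIdeal_iff (hS : IsNumericalSemigroup S) {A : Set ℕ} (hA : A.Nonempty)
    (hAS : A ⊆ S) {f : semigroupRing k S} :
    f ∈ monomialIdeal k S A ↔
      ∀ n, PowerSeries.coeff n (f : PowerSeries k) ≠ 0 → n ∈ A + (S : Set ℕ) := by
  have hgen : ∀ {a : ℕ} (ha : a ∈ A), monomial (1 : k) (hAS ha) ∈ monomialIdeal k S A :=
    fun {a} ha => Ideal.subset_span ⟨a, ha, (PowerSeries.X_pow_eq a).symm⟩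
  constructor
  · intro hf
    induction hf using Submodule.span_induction with
    | mem f hf =>
      obtain ⟨a, ha, hfa⟩ := hf
      intro n hn
      rw [hfa, PowerSeries.coeff_X_pow] at hn
      obtain rfl : n = a := by
        by_contra h
        exact hn (if_neg h)
      exact ⟨n, ha, 0, S.zero_mem, add_zero n⟩
    | zero => simp
    | add f g _ _ hf hg =>
      intro n hn
      by_cases h : PowerSeries.coeff n (f : PowerSeries k) = 0
      · refine hg n fun h' => hn ?_
        rw [Subalgebra.coe_add, map_add, h, h', add_zero]
      · exact hf n h
    | smul r f _ hf =>
      intro n hn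
      rw [smul_eq_mul, Subalgebra.coe_mul, PowerSeries.coeff_mul] at hn
      obtain ⟨p, hp, hpn⟩ := Finset.exists_ne_zero_of_sum_ne_zero hn
      obtain ⟨a, ha, s, hs, has⟩ := hf _ (right_ne_zero_of_mul hpn)
      refine ⟨a, ha, p.1 + s, S.add_mem (r.2 _ (left_ne_zero_of_mul hpn)) hs, ?_⟩
      have := Finset.HasAntidiagonal.mem_antidiagonal.mp hp
      dsimp only at has ⊢
      omega
  · intro hf
    obtain ⟨a, ha⟩ := hA
    obtain ⟨c, hc⟩ := hS.exists_forall_ge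
    -- Remove the coefficients in degrees below `a + c` one at a time, starting from the lowest.
    suffices h : ∀ d (f : semigroupRing k S),
        (∀ n, PowerSeries.coeff n (f : PowerSeries k) ≠ 0 → n ∈ A + (S : Set ℕ)) →
        (∀ n < a + c - d, PowerSeries.coeff n (f : PowerSeries k) = 0) →
        f ∈ monomialIdeal k S A from h (a + c) f hf (by simp)
    intro d
    induction d with
    | zero =>
      intro f _ hlt
      obtain ⟨g, hg⟩ := PowerSeries.X_pow_dvd_iff.mpr (show ∀ n < a, _ from
        fun n hn => hlt n (by omega))
      -- `f = t^a * g`, and `g` has order at least `c`, so that `g ∈ k[[S]]`.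
      have hgS : g ∈ semigroupRing k S := by
        intro n hn
        refine hc n (not_lt.mp fun hnc => hn ?_)
        have := hlt (n + a) (by omega)
        rwa [hg, add_comm n a, PowerSeries.coeff_X_pow_mul',
          if_pos (Nat.le_add_right a n), Nat.add_sub_cancel_left] at this
      have : f = (⟨g, hgS⟩ : semigroupRing k S) * monomial (1 : k) (hAS ha) := by
        apply Subtype.ext
        rw [hg, Subalgebra.coe_mul, coe_monomial, ← PowerSeries.X_pow_eq, mul_comm]
      rw [this]
      exact Ideal.mul_mem_left _ _ (hgen ha)
    | succ d ih =>
      intro f hf hlt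
      by_cases hd : PowerSeries.coeff (a + c - (d + 1)) (f : PowerSeries k) = 0
      · refine ih f hf fun n hn => ?_
        rcases eq_or_ne n (a + c - (d + 1)) with rfl | hne
        · exact hd
        · exact hlt n (by omega)
      · obtain ⟨b, hb, s, hs, hbs⟩ := hf _ hd
        dsimp only at hbs
        obtain ⟨r, hr⟩ : ∃ r, r = PowerSeries.coeff (b + s) (f : PowerSeries k) := ⟨_, rfl⟩
        obtain ⟨g, hg⟩ : ∃ g, g = monomial r hs * monomial (1 : k) (hAS hb) := ⟨_, rfl⟩
        have hgc : (g : PowerSeries k) = PowerSeries.monomial (b + s) r := by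
          rw [hg, Subalgebra.coe_mul, coe_monomial, coe_monomial,
            PowerSeries.monomial_mul_monomial, mul_one, add_comm]
        have hgI : g ∈ monomialIdeal k S A := hg ▸ Ideal.mul_mem_left _ _ (hgen hb)
        rw [← sub_add_cancel f g]
        refine Ideal.add_mem _ (ih _ (fun n hn => ?_) fun n hn => ?_) hgI
        · rw [Subalgebra.coe_sub, map_sub, hgc, PowerSeries.coeff_monomial] at hn
          split_ifs at hn with h
          · exact ⟨b, hb, s, hs, h.symm⟩
          · exact hf n (by simpa using hn)
        · rw [Subalgebra.coe_sub, map_sub, hgc, PowerSeries.coeff_monomial]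
          split_ifs with h
          · rw [hr, h, sub_self]
          · rw [hlt n (by omega), sub_zero]

theorem monomialIdeal_add {A B : Set ℕ} (hA : A ⊆ S) (hB : B ⊆ S) :
    monomialIdeal k S (A + B) = monomialIdeal k S A * monomialIdeal k S B := by
  rw [monomialIdeal, monomialIdeal, monomialIdeal, Ideal.span_mul_span']
  congr 1
  ext f
  constructor
  · rintro ⟨_, ⟨a, ha, b, hb, rfl⟩, hf⟩
    refine ⟨monomial 1 (hA ha), ⟨a, ha, (PowerSeries.X_pow_eq a).symm⟩,
      monomial 1 (hB hb), ⟨b, hb, (PowerSeries.X_pow_eq b).symm⟩, Subtype.ext ?_⟩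
    rw [hf]
    dsimp only
    rw [Subalgebra.coe_mul, coe_monomial, coe_monomial, ← PowerSeries.X_pow_eq,
      ← PowerSeries.X_pow_eq, pow_add]
  · rintro ⟨g, ⟨a, ha, hg⟩, h, ⟨b, hb, hh⟩, rfl⟩
    exact ⟨a + b, ⟨a, ha, b, hb, rfl⟩, by dsimp only; rw [Subalgebra.coe_mul, hg, hh, pow_add]⟩

theorem IsIdeal.monomialIdeal_pow (hE : IsIdeal S E) (n : ℕ) :
    monomialIdeal k S E ^ n = monomialIdeal k S (sumset n E) := by
  induction n with
  | zero =>
    rw [pow_zero, Ideal.one_eq_top, eq_comm, Ideal.eq_top_iff_one]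
    exact Ideal.subset_span ⟨0, rfl, by simp⟩
  | succ n ih => rw [pow_succ, ih, sumset, monomialIdeal_add (hE.sumset_subset n) hE.subset]

theorem mem_monomialIdeal_pow_iff (hS : IsNumericalSemigroup S) (hE : IsIdeal S E) {n : ℕ}
    {f : semigroupRing k S} :
    f ∈ monomialIdeal k S E ^ n ↔
      ∀ j, PowerSeries.coeff j (f : PowerSeries k) ≠ 0 → j ∈ idealPow S E n := by
  have hne : (sumset n E).Nonempty := by
    rw [sumset_eq_nsmul]
    exact hE.nonempty.nsmul
  rw [hE.monomialIdeal_pow, mem_monomialIdeal_iff hS hne (hE.sumset_subset n), idealPow]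

theorem monomial_mem_pow_iff (hS : IsNumericalSemigroup S) (hE : IsIdeal S E) {n s : ℕ}
    (hs : s ∈ S) : monomial (1 : k) hs ∈ monomialIdeal k S E ^ n ↔ s ∈ idealPow S E n := by
  rw [mem_monomialIdeal_pow_iff hS hE]
  simp [coe_monomial, PowerSeries.coeff_monomial]

/-- Colon ideals between powers of a monomial ideal are monomial: membership can be tested on the
exponents. -/
theorem mem_colon_iff (hS : IsNumericalSemigroup S) (hE : IsIdeal S E) {m n : ℕ}
    {f : semigroupRing k S} :
    f ∈ (monomialIdeal k S E ^ m).colon (monomialIdeal k S E ^ n : Ideal (semigroupRing k S)) ↔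
      ∀ j, PowerSeries.coeff j (f : PowerSeries k) ≠ 0 →
        ∀ x ∈ idealPow S E n, j + x ∈ idealPow S E m := by
  rw [Submodule.mem_colon]
  constructor
  · intro h j hj x hx
    have hxS := hE.idealPow_subset n hx
    have := (mem_monomialIdeal_pow_iff hS hE).mp
      (h _ ((monomial_mem_pow_iff hS hE hxS).mpr hx)) (j + x)
    apply this
    rwa [smul_eq_mul, Subalgebra.coe_mul, coe_monomial, ← PowerSeries.X_pow_eq,
      PowerSeries.coeff_mul_X_pow]
  · intro h g hg
    rw [smul_eq_mul, mem_monomialIdeal_pow_iff hS hE]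
    intro j hj
    rw [Subalgebra.coe_mul, PowerSeries.coeff_mul] at hj
    obtain ⟨p, hp, hpn⟩ := Finset.exists_ne_zero_of_sum_ne_zero hj
    rw [← Finset.HasAntidiagonal.mem_antidiagonal.mp hp]
    exact h _ (left_ne_zero_of_mul hpn) _
      ((mem_monomialIdeal_pow_iff hS hE).mp hg _ (right_ne_zero_of_mul hpn))

theorem monomial_mem_ratliffRush_iff (hS : IsNumericalSemigroup S) (hE : IsIdeal S E) {m s : ℕ}
    (hs : s ∈ S) :
    monomial (1 : k) hs ∈ ratliffRush (monomialIdeal k S E ^ m) ↔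
      ∃ n, 1 ≤ n ∧ ∀ x ∈ idealPow S E (m * n), s + x ∈ idealPow S E (m * (n + 1)) := by
  change (∃ n, 1 ≤ n ∧ _ ∈ ((monomialIdeal k S E ^ m) ^ (n + 1)).colon _) ↔ _
  simp only [← pow_mul, mem_colon_iff hS hE]
  simp [coe_monomial, PowerSeries.coeff_monomial]

theorem pow_eq_ratliffRush_iff (hS : IsNumericalSemigroup S) (hE : IsIdeal S E) {m : ℕ} :
    monomialIdeal k S E ^ m = ratliffRush (monomialIdeal k S E ^ m) ↔
      ∀ s ∈ S, (∃ n, 1 ≤ n ∧ ∀ x ∈ idealPow S E (m * n), s + x ∈ idealPow S E (m * (n + 1))) →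
        s ∈ idealPow S E m := by
  constructor
  · intro h s hs hex
    rw [← monomial_mem_pow_iff (k := k) hS hE hs, h]
    exact (monomial_mem_ratliffRush_iff hS hE hs).mpr hex
  · intro h
    ext f
    constructor
    · intro hf
      refine ⟨1, le_rfl, Submodule.mem_colon.mpr fun g hg => ?_⟩
      rw [pow_one] at hg
      rw [smul_eq_mul, pow_two]
      exact Ideal.mul_mem_mul hf hg
    · rintro ⟨n, hn, hf⟩
      rw [← pow_mul, ← pow_mul, mem_colon_iff hS hE] at hf
      exact (mem_monomialIdeal_pow_iff hS hE).mpr fun j hj => h j (f.2 j hj) ⟨n, hn, hf j hj⟩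

end NumSgp

theorem asymptoticRatliffRush_eq_one_iff {R : Type*} [CommRing R] (I : Ideal R) :
    asymptoticRatliffRush I = 1 ↔ ∀ m, 1 ≤ m → I ^ m = ratliffRush (I ^ m) := by
  rw [asymptoticRatliffRush]
  constructor
  · intro h
    have hmem := Nat.sInf_mem (Nat.nonempty_of_pos_sInf (h ▸ one_pos))
    rw [h] at hmem
    exact hmem.2
  · intro h
    exact le_antisymm (Nat.sInf_le ⟨le_rfl, h⟩) (le_csInf ⟨1, le_rfl, h⟩ fun n hn => hn.1)

theorem mainTheorem2 {k : Type*} [Field k] (S : AddSubmonoid ℕ)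
    (hS : NumSgp.IsNumericalSemigroup S) (E : Set ℕ) (hE : NumSgp.IsIdeal S E) :
    asymptoticRatliffRush (NumSgp.monomialIdeal k S E) = 1 ↔
      ∀ i < NumSgp.idealMult E,
        NumSgp.microinv (NumSgp.adjoinZero hE) (NumSgp.translate (NumSgp.idealMult E) S) i =
          (NumSgp.order (NumSgp.adjoinZero hE)
            (NumSgp.translate (NumSgp.idealMult E) S) i : ℤ) := by
  simp only [asymptoticRatliffRush_eq_one_iff, NumSgp.pow_eq_ratliffRush_iff hS hE]
  by_cases h0 : 0 ∈ E
  · have he : NumSgp.idealMult E = 0 := Nat.sInf_eq_zero.mpr (Or.inl h0)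
    simp only [he, Nat.not_lt_zero, IsEmpty.forall_iff, implies_true, iff_true]
    intro m _ s hs _
    have := NumSgp.add_mem_idealPow (NumSgp.mul_mem_idealPow (S := S) h0 m)
      (NumSgp.idealPow_zero (S := S) (E := E) ▸ hs : s ∈ NumSgp.idealPow S E 0)
    simpa using this
  · rw [NumSgp.forall_microinv_eq_order_iff hS hE h0]
    refine forall₂_congr fun m hm => forall₂_congr fun s _ => ?_
    rw [NumSgp.exists_forall_add_mem_idealPow_iff hS hE h0 hm]
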